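/- For an abstract simplicial complex $K$ let $|K|$ denote its geometric realization (with the weak topology). A triangulation of a topological space $X$ by $K$ is a homeomorphism $\tau\colon |K|\to X$. Given triangulations $\tau\colon |K|\to X$ and $\tau'\colon |K'|\to X'$, a map $p\colon X'\to X$ is called simplicial with respect to $K'$ and $K$ if $\tau^{-1}\circ p\circ\tau'\colon |K'|\to |K|$ is the realization $|f|$ of a morphism $f\colon K'\to K$ of abstract simplicial complexes, i.e. of a vertex map that sends simplices to simplices, extended affinely over each simplex. A complex is locally finite if every vertex lies in only finitely many simplices. Let $X$ be a topological space with a triangulation $\tau\colon |K|\to X$ by a finite-dimensional, locally finite simplicial complex $K$, and let $p\colon X'\to X$ be a topological covering map. Then there exist a locally finite simplicial complex $K'$ and a triangulation $\tau'\colon |K'|\to X'$ such that $p$ is simplicial with respect to $K'$ and $K$ (with $\tau$ unchanged). -/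

import Mathlib

universe u v w

namespace AbstractSimplicialComplex

/-- The complex has some finite dimension: there is `n` such that every simplex has at most
`n + 1` vertices. -/
def IsFiniteDimensional {V : Type u} (K : AbstractSimplicialComplex V) : Prop :=
  ∃ n : ℕ, ∀ s ∈ K.faces, s.card ≤ n + 1

/-- Every vertex lies in only finitely many simplices. -/
def IsLocallyFinite {V : Type u} (K : AbstractSimplicialComplex V) : Prop :=
  ∀ a : V, {s : Finset V | s ∈ K.faces ∧ a ∈ s}.Finite

/-- The points of the geometric realization `|K|`: finitely supported families of barycentric
coordinates `(x_a)` over the vertices, `x_a ≥ 0`, `∑ x_a = 1`, whose support is a simplex. -/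
@[ext]
structure Realization {V : Type u} (K : AbstractSimplicialComplex V) : Type u where
  coords : V →₀ ℝ
  nonneg : ∀ a, 0 ≤ coords a
  sum_eq_one : (coords.sum fun _ r => r) = 1
  support_mem : coords.support ∈ K.faces

/-- A vertex map `V → W` that sends simplices of `K` to simplices of `L`. -/
structure SimplicialMap {V : Type u} {W : Type v} (K : AbstractSimplicialComplex V)
    (L : AbstractSimplicialComplex W) : Type (max u v) where
  toFun : V → W
  image_mem : ∀ s ∈ K.faces, ∃ t ∈ L.faces, (t : Set W) = toFun '' (s : Set V)

theorem sum_mapDomain {V : Type u} {W : Type v} (f : V → W) (x : V →₀ ℝ) :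
    ((x.mapDomain f).sum fun _ r => r) = x.sum fun _ r => r :=
  Finsupp.sum_mapDomain_index (fun _ => rfl) (fun _ _ _ => rfl)

theorem mapDomain_nonneg {V : Type u} {W : Type v} (f : V → W) (x : V →₀ ℝ)
    (hx : ∀ a, 0 ≤ x a) (b : W) : 0 ≤ x.mapDomain f b := by
  classical
  rw [Finsupp.mapDomain, Finsupp.sum_apply]
  refine Finset.sum_nonneg fun a _ => ?_
  change 0 ≤ Finsupp.single (f a) (x a) b
  rw [Finsupp.single_apply]
  split_ifs
  · exact hx a
  · exact le_rfl

theorem support_nonempty {V : Type u} (x : V →₀ ℝ) (hx : (x.sum fun _ r => r) = 1) :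
    x.support.Nonempty := by
  by_contra h
  rw [Finset.not_nonempty_iff_eq_empty, Finsupp.support_eq_empty] at h
  simp [h] at hx

theorem support_mapDomain_mem {V : Type u} {W : Type v} (L : AbstractSimplicialComplex W)
    (f : V → W) (x : V →₀ ℝ) (hx : (x.sum fun _ r => r) = 1) (t : Finset W) (ht : t ∈ L.faces)
    (h : ∀ a ∈ x.support, f a ∈ t) : (x.mapDomain f).support ∈ L.faces := by
  classical
  refine (L.isRelLowerSet_faces ht).2 ?_ ?_
  · refine Finset.Subset.trans Finsupp.mapDomain_support fun b hb => ?_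
    obtain ⟨a, ha, rfl⟩ := Finset.mem_image.1 hb
    exact h a ha
  · exact support_nonempty _ ((sum_mapDomain f x).trans hx)

/-- The simplicial map `|K| → |L|` of realizations induced by a vertex map `f`: it is affine on
every simplex, so the coordinate of the image point at `b` is the sum of `x_a` over `f a = b`. -/
noncomputable def SimplicialMap.realization {V : Type u} {W : Type v}
    {K : AbstractSimplicialComplex V} {L : AbstractSimplicialComplex W} (f : SimplicialMap K L)
    (x : K.Realization) : L.Realization where
  coords := x.coords.mapDomain f.toFun
  nonneg := mapDomain_nonneg _ _ x.nonneg
  sum_eq_one := (sum_mapDomain _ _).trans x.sum_eq_one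
  support_mem := by
    obtain ⟨t, ht, hts⟩ := f.image_mem _ x.support_mem
    refine support_mapDomain_mem L _ _ x.sum_eq_one t ht fun a ha => ?_
    rw [← Finset.mem_coe, hts]
    exact Set.mem_image_of_mem _ ha

/-- The inclusion into `|K|` of the closed simplex spanned by a face `s`, parametrized by the
standard simplex on the vertex set `s`. -/
noncomputable def faceInclusion {V : Type u} (K : AbstractSimplicialComplex V)
    (s : K.faces) (x : stdSimplex ℝ (s : Finset V)) : K.Realization where
  coords := (Finsupp.equivFunOnFinite.symm x.1).mapDomain Subtype.val
  nonneg := mapDomain_nonneg _ _ x.2.1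
  sum_eq_one := by
    rw [sum_mapDomain, Finsupp.sum_fintype _ _ fun _ => rfl]
    exact x.2.2
  support_mem := by
    refine support_mapDomain_mem K _ _ ?_ s s.2 fun a _ => a.2
    rw [Finsupp.sum_fintype _ _ fun _ => rfl]
    exact x.2.2

/-- The weak (coherent) topology on `|K|`: a set is open (closed) if and only if its preimage in
every closed simplex is open (closed), the simplex carrying its Euclidean topology. -/
noncomputable instance {V : Type u} (K : AbstractSimplicialComplex V) : TopologicalSpace K.Realization :=
  ⨆ s : K.faces, TopologicalSpace.coinduced (K.faceInclusion s) inferInstance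

/-- A triangulation of a space `X` by `K`: a homeomorphism `|K| ≃ X`. -/
abbrev Triangulation {V : Type u} (K : AbstractSimplicialComplex V) (X : Type w)
    [TopologicalSpace X] : Type (max u w) :=
  K.Realization ≃ₜ X

/-- A map `p : X → Y` is simplicial with respect to triangulations `σ : |K| ≃ X` and
`τ : |L| ≃ Y` if `τ⁻¹ ∘ p ∘ σ : |K| → |L|` is the realization of a simplicial map `K → L`. -/
def IsSimplicialFor {V : Type u} {W : Type v} {K : AbstractSimplicialComplex V}
    {L : AbstractSimplicialComplex W} {X Y : Type*} [TopologicalSpace X] [TopologicalSpace Y]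
    (σ : K.Triangulation X) (τ : L.Triangulation Y) (p : X → Y) : Prop :=
  ∃ f : SimplicialMap K L, ∀ x : K.Realization, τ.symm (p (σ x)) = f.realization x

end AbstractSimplicialComplex

/-!
After composing with `τ⁻¹` one may assume that the base is `|K|`, so let `q : E → |K|` be a covering
map. A closed simplex `Δ` of `|K|` is contractible and connected, so for each `e : E` over a point
of `Δ` there is exactly one lift `Δ → E` through `e`
(`FaceLift.exists_of_proj_eq`, `FaceLift.eq_of_apply_eq`). The vertices upstairs are the points of
`E` over vertices of `K`, and the simplices of `liftedComplex` are the vertex sets of the lifts. No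
subdivision is needed: two lifts of the same simplex with a common vertex are equal, so a lift is
determined by its vertex set. The same uniqueness makes the simplices at a vertex upstairs
correspond injectively to simplices at the vertex below it, hence the lifted complex is locally
finite.

The homeomorphism `|K'| ≃ E` sends the abstract simplex belonging to a lift onto the lift, keeping
barycentric coordinates. It is well defined and injective by `FaceLift.map_eq_map_iff`: restricting
to carriers, one compares interior points of lifts of one and the same simplex. It is surjective
because each point of `E` lies on a lift. It is continuous by the definition of the weak topology,
and so is its inverse, because `E` carries the weak topology with respect to the lifts
(`isOpen_of_forall_faceLift`): this may be tested inside a sheet of `q`, where it reduces to the weak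
topology of `|K|`.
-/

namespace AbstractSimplicialComplex

open Topology

/-! ### Closed simplices of the realization -/

section FaceInclusion

variable {V : Type u} (K : AbstractSimplicialComplex V)

instance nonempty_face (s : K.faces) : Nonempty (s : Finset V) :=
  (K.isRelLowerSet_faces s.2).1.to_subtype

theorem continuous_faceInclusion (s : K.faces) : Continuous (K.faceInclusion s) :=
  continuous_iff_coinduced_le.2
    (le_iSup (fun s : K.faces => TopologicalSpace.coinduced (K.faceInclusion s) inferInstance) s)

variable {K}

theorem Realization.continuous_iff {Y : Type*} [TopologicalSpace Y] {g : K.Realization → Y} :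
    Continuous g ↔ ∀ s : K.faces, Continuous (g ∘ K.faceInclusion s) := by
  simp only [continuous_iSup_dom, continuous_coinduced_dom]

theorem Realization.isOpen_iff {U : Set K.Realization} :
    IsOpen U ↔ ∀ s : K.faces, IsOpen (K.faceInclusion s ⁻¹' U) := by
  simp only [isOpen_iSup_iff, isOpen_coinduced]

theorem equivFunOnFinite_symm_map {ι κ : Type*} [Fintype ι] [Fintype κ] (g : ι → κ)
    (z : stdSimplex ℝ ι) :
    Finsupp.equivFunOnFinite.symm (stdSimplex.map g z).1 =
      (Finsupp.equivFunOnFinite.symm z.1).mapDomain g :=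
  Equiv.symm_apply_apply Finsupp.equivFunOnFinite _

theorem faceInclusion_map_coords (t : K.faces) {ι : Type*} [Fintype ι] (g : ι → (t : Finset V))
    (z : stdSimplex ℝ ι) :
    (K.faceInclusion t (stdSimplex.map g z)).coords =
      (Finsupp.equivFunOnFinite.symm z.1).mapDomain fun i => (g i : V) := by
  change (Finsupp.equivFunOnFinite.symm (stdSimplex.map g z).1).mapDomain Subtype.val = _
  rw [equivFunOnFinite_symm_map, ← Finsupp.mapDomain_comp]
  rfl

theorem faceInclusion_coords_apply (s : K.faces) (z : stdSimplex ℝ (s : Finset V))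
    (a : (s : Finset V)) : (K.faceInclusion s z).coords a = z a :=
  Finsupp.mapDomain_apply Subtype.val_injective _ _

theorem faceInclusion_support_subset (s : K.faces) (z : stdSimplex ℝ (s : Finset V)) :
    (K.faceInclusion s z).coords.support ⊆ s := by
  classical
  refine Finset.Subset.trans Finsupp.mapDomain_support fun b hb => ?_
  obtain ⟨a, -, rfl⟩ := Finset.mem_image.1 hb
  exact a.2

theorem faceInclusion_injective (s : K.faces) : Function.Injective (K.faceInclusion s) := by
  intro z w h
  ext a
  rw [← faceInclusion_coords_apply, h, faceInclusion_coords_apply]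

/-- The carrier of a point `x` of `|K|`: the unique simplex containing `x` in its interior. -/
def Realization.carrier (x : K.Realization) : K.faces := ⟨x.coords.support, x.support_mem⟩

theorem faceInclusion_map_inclusion {s t : K.faces} (h : (s : Finset V) ⊆ t)
    (z : stdSimplex ℝ (s : Finset V)) :
    K.faceInclusion t (stdSimplex.map (Set.inclusion h) z) = K.faceInclusion s z :=
  Realization.ext (faceInclusion_map_coords t _ z)

theorem Realization.exists_faceInclusion_carrier (x : K.Realization) :
    ∃ z, K.faceInclusion x.carrier z = x := by
  have hsum : ∑ a : (x.carrier : Finset V), x.coords a = 1 := by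
    rw [← x.sum_eq_one]
    exact Finset.sum_coe_sort x.coords.support x.coords
  refine ⟨⟨fun a => x.coords a, fun a => x.nonneg a, hsum⟩, Realization.ext ?_⟩
  ext b
  by_cases hb : b ∈ (x.carrier : Finset V)
  · exact faceInclusion_coords_apply _ _ ⟨b, hb⟩
  · rw [Finsupp.notMem_support_iff.1 hb,
      Finsupp.notMem_support_iff.1 fun h => hb (faceInclusion_support_subset _ _ h)]

variable (K) in
/-- The point of `|K|` given by a vertex of `K`. -/
noncomputable def vertexPoint (a : V) : K.Realization where
  coords := Finsupp.single a 1
  nonneg b := by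
    classical
    rw [Finsupp.single_apply]
    split_ifs
    exacts [zero_le_one, le_rfl]
  sum_eq_one := Finsupp.sum_single_index rfl
  support_mem := by
    have : (Finsupp.single a (1 : ℝ)).support = {a} := by simp
    rw [this]
    exact K.singleton_mem a

theorem vertexPoint_injective : Function.Injective K.vertexPoint := fun _ _ h =>
  (Finsupp.single_left_inj one_ne_zero).1 (congrArg Realization.coords h)

open Classical in
theorem faceInclusion_vertex (s : K.faces) (a : (s : Finset V)) :
    K.faceInclusion s (stdSimplex.vertex a) = K.vertexPoint a := by
  refine Realization.ext ?_
  change (Finsupp.equivFunOnFinite.symm (Pi.single a (1 : ℝ))).mapDomain Subtype.val = _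
  rw [Finsupp.equivFunOnFinite_symm_single, Finsupp.mapDomain_single]
  rfl

end FaceInclusion

/-! ### Lifts of simplices -/

section Lift

variable {V : Type u} {K : AbstractSimplicialComplex V} {E : Type v} [TopologicalSpace E]

/-- A lift through `q : E → |K|` of the closed simplex of `|K|` spanned by the face `s`. -/
structure FaceLift (q : E → K.Realization) (s : K.faces) where
  /-- The underlying singular simplex in `E`. -/
  map : C(stdSimplex ℝ (s : Finset V), E)
  proj : ∀ z, q (map z) = K.faceInclusion s z

/-- The vertices upstairs: the points of `E` lying over vertices of `K`. -/
@[ext]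
structure LiftedVertex (q : E → K.Realization) : Type v where
  /-- The underlying point of `E`. -/
  point : E
  exists_proj_eq : ∃ a, q point = K.vertexPoint a

/-- The vertex of `K` over which a vertex upstairs lies. -/
noncomputable def LiftedVertex.base {q : E → K.Realization} (b : LiftedVertex q) : V :=
  b.exists_proj_eq.choose

namespace FaceLift

variable {q : E → K.Realization} {s t : K.faces}

/-- Two lifts of the same simplex that agree at one point are equal. -/
theorem eq_of_apply_eq (hq : IsCoveringMap q) {L L' : FaceLift q s}
    (z : stdSimplex ℝ (s : Finset V)) (h : L.map z = L'.map z) : L = L' := by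
  cases L with | mk f hf =>
  cases L' with | mk g hg =>
  have : (f : _ → E) = g := hq.eq_of_comp_eq f.continuous g.continuous
    (funext fun w => (hf w).trans (hg w).symm) z h
  obtain rfl := DFunLike.coe_injective this
  rfl

/-- A simplex lifts through a covering map, with one value prescribed: the straight-line
contraction of the simplex onto a point is lifted by the homotopy lifting property. -/
theorem exists_of_proj_eq (hq : IsCoveringMap q) (z : stdSimplex ℝ (s : Finset V)) (e : E)
    (h : q e = K.faceInclusion s z) : ∃ L : FaceLift q s, L.map z = e := by
  let c : C(unitInterval × stdSimplex ℝ (s : Finset V), stdSimplex ℝ (s : Finset V)) :=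
    { toFun := fun p => ⟨(1 - (p.1 : ℝ)) • z.1 + (p.1 : ℝ) • p.2.1,
        convex_stdSimplex ℝ _ z.2 p.2.2 (sub_nonneg.2 p.1.2.2) p.1.2.1 (by ring)⟩
      continuous_toFun := by fun_prop }
  have c_zero : ∀ w, c (0, w) = z := fun w => Subtype.ext (by simp [c])
  have c_one : ∀ w, c (1, w) = w := fun w => Subtype.ext (by simp [c])
  have c_self : ∀ r, c (r, z) = z := fun r => Subtype.ext (by simp [c, ← add_smul])
  let H : C(unitInterval × stdSimplex ℝ (s : Finset V), K.Realization) :=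
    ⟨fun p => K.faceInclusion s (c p), (K.continuous_faceInclusion s).comp c.continuous⟩
  have H_zero : ∀ w, H (0, w) = q (ContinuousMap.const _ e w) := fun w => by
    simp only [H, ContinuousMap.coe_mk, c_zero, ContinuousMap.const_apply, h]
  let G := hq.liftHomotopy H (.const _ e) H_zero
  have hG : ∀ p, q (G p) = H p := congr_fun (hq.liftHomotopy_lifts H (.const _ e) H_zero)
  refine ⟨⟨⟨fun w => G (1, w), by fun_prop⟩, fun w => ?_⟩, ?_⟩
  · simp only [ContinuousMap.coe_mk, hG, H, c_one]
  · -- The path `r ↦ G (r, z)` lifts a constant path, so it is constant.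
    refine (hq.const_of_comp (g := fun r => G (r, z)) (by fun_prop) (fun r r' => ?_) 1 0).trans
      (hq.liftHomotopy_zero H (.const _ e) H_zero z)
    simp only [hG, H, ContinuousMap.coe_mk, c_self]

/-- The restriction of a lift to a face of the simplex. -/
noncomputable def restrict (L : FaceLift q t) (h : (s : Finset V) ⊆ t) : FaceLift q s where
  map := ⟨fun z => L.map (stdSimplex.map (Set.inclusion h) z),
    L.map.continuous.comp (stdSimplex.continuous_map _)⟩
  proj z := (L.proj _).trans (faceInclusion_map_inclusion h z)

open Classical in
/-- The vertices of a lifted simplex. -/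
noncomputable def vertex (L : FaceLift q s) (a : (s : Finset V)) : LiftedVertex q :=
  ⟨L.map (stdSimplex.vertex a), a, (L.proj _).trans (faceInclusion_vertex s a)⟩

@[simp]
theorem base_vertex (L : FaceLift q s) (a : (s : Finset V)) : (L.vertex a).base = a :=
  vertexPoint_injective ((L.vertex a).exists_proj_eq.choose_spec.symm.trans
    ((L.proj _).trans (faceInclusion_vertex s a)))

theorem vertex_injective (L : FaceLift q s) : Function.Injective L.vertex := fun a b h =>
  Subtype.ext (by rw [← L.base_vertex a, h, L.base_vertex])

theorem restrict_vertex (L : FaceLift q t) (h : (s : Finset V) ⊆ t) (a : (s : Finset V)) :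
    (L.restrict h).vertex a = L.vertex (Set.inclusion h a) := by
  classical
  refine LiftedVertex.ext (congrArg L.map ?_)
  convert stdSimplex.map_vertex (S := ℝ) (Set.inclusion h) a

theorem eq_of_vertex_eq (hq : IsCoveringMap q) {L L' : FaceLift q s} (a : (s : Finset V))
    (h : L.vertex a = L'.vertex a) : L = L' :=
  eq_of_apply_eq hq _ (congrArg LiftedVertex.point h)

/-- The vertex set of a lifted simplex. -/
noncomputable def vertexSet (L : FaceLift q s) : Finset (LiftedVertex q) :=
  Finset.univ.map ⟨L.vertex, L.vertex_injective⟩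

theorem mem_vertexSet {L : FaceLift q s} {b : LiftedVertex q} :
    b ∈ L.vertexSet ↔ ∃ a, L.vertex a = b := by
  simp [vertexSet]

theorem base_image_vertexSet (L : FaceLift q s) :
    LiftedVertex.base '' (L.vertexSet : Set (LiftedVertex q)) = (s : Finset V) := by
  ext a
  simp only [Set.mem_image, Finset.mem_coe, mem_vertexSet]
  constructor
  · rintro ⟨_, ⟨a, rfl⟩, rfl⟩
    rw [base_vertex]
    exact a.2
  · exact fun ha => ⟨_, ⟨⟨a, ha⟩, rfl⟩, base_vertex L _⟩

/-- Different lifts of one simplex have disjoint vertex sets. As the simplex itself is the image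
of the vertex set of a lift, every lift is determined by its vertex set. -/
theorem eq_of_mem_vertexSet (hq : IsCoveringMap q) {L L' : FaceLift q s} {b : LiftedVertex q}
    (h : b ∈ L.vertexSet) (h' : b ∈ L'.vertexSet) : L = L' := by
  obtain ⟨a, rfl⟩ := mem_vertexSet.1 h
  obtain ⟨a', ha'⟩ := mem_vertexSet.1 h'
  have : a' = a := Subtype.ext (by rw [← L'.base_vertex, ha', L.base_vertex])
  subst this
  exact eq_of_vertex_eq hq a' ha'.symm

end FaceLift

/-! ### The lifted complex -/

variable {q : E → K.Realization}

/-- The complex upstairs: its simplices are the vertex sets of lifts of simplices of `K`. -/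
def liftedComplex (hq : IsCoveringMap q) : AbstractSimplicialComplex (LiftedVertex q) where
  faces := {t | ∃ (s : K.faces) (L : FaceLift q s), L.vertexSet = t}
  isRelLowerSet_faces := by
    classical
    rintro _ ⟨s, L, rfl⟩
    refine ⟨?_, fun t ht htne => ?_⟩
    · obtain ⟨a⟩ := K.nonempty_face s
      exact ⟨_, FaceLift.mem_vertexSet.2 ⟨a, rfl⟩⟩
    · have hsub : t.image LiftedVertex.base ⊆ (s : Finset V) := fun a ha => by
        obtain ⟨b, hb, rfl⟩ := Finset.mem_image.1 ha
        obtain ⟨a, rfl⟩ := FaceLift.mem_vertexSet.1 (ht hb)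
        rw [L.base_vertex]
        exact a.2
      refine ⟨⟨_, (K.isRelLowerSet_faces s.2).2 hsub (htne.image _)⟩, L.restrict hsub, ?_⟩
      ext b
      rw [FaceLift.mem_vertexSet]
      constructor
      · rintro ⟨⟨a, ha⟩, rfl⟩
        obtain ⟨b, hb, rfl⟩ := Finset.mem_image.1 ha
        obtain ⟨a, rfl⟩ := FaceLift.mem_vertexSet.1 (ht hb)
        rw [L.restrict_vertex]
        convert hb
        exact Subtype.ext (L.base_vertex a)
      · intro hb
        obtain ⟨a, rfl⟩ := FaceLift.mem_vertexSet.1 (ht hb)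
        refine ⟨⟨_, Finset.mem_image_of_mem _ hb⟩, ?_⟩
        rw [L.restrict_vertex]
        congr 1
        exact Subtype.ext (L.base_vertex a)
  singleton_mem b := by
    classical
    obtain ⟨e, a, he⟩ := b
    let s : K.faces := ⟨{a}, K.singleton_mem a⟩
    have ha : a ∈ (s : Finset V) := Finset.mem_singleton_self a
    obtain ⟨L, hL⟩ := FaceLift.exists_of_proj_eq (s := s) hq (stdSimplex.vertex ⟨a, ha⟩) e
      (he.trans (by convert (faceInclusion_vertex s ⟨a, ha⟩).symm))
    have hv : L.vertex ⟨a, ha⟩ = ⟨e, a, he⟩ := LiftedVertex.ext (by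
      refine Eq.trans ?_ hL
      unfold FaceLift.vertex
      congr!)
    refine ⟨s, L, ?_⟩
    ext b
    rw [FaceLift.mem_vertexSet, Finset.mem_singleton, ← hv]
    constructor
    · rintro ⟨⟨a', ha'⟩, rfl⟩
      obtain rfl := Finset.mem_singleton.1 ha'
      rfl
    · rintro rfl
      exact ⟨_, rfl⟩

theorem liftedComplex_isLocallyFinite (hq : IsCoveringMap q) (hK : K.IsLocallyFinite) :
    (liftedComplex hq).IsLocallyFinite := by
  classical
  intro b
  have key : ∀ {s : K.faces} (L : FaceLift q s), L.vertexSet.image LiftedVertex.base = s :=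
    fun L => Finset.coe_injective (by rw [Finset.coe_image, L.base_image_vertexSet])
  refine Set.Finite.of_finite_image (f := Finset.image LiftedVertex.base)
    ((hK b.base).subset ?_) ?_
  · rintro _ ⟨_, ⟨⟨s, L, rfl⟩, hb⟩, rfl⟩
    refine ⟨?_, Finset.mem_image_of_mem _ hb⟩
    rw [key]
    exact s.2
  · rintro _ ⟨⟨s, L, rfl⟩, hb⟩ _ ⟨⟨s', L', rfl⟩, hb'⟩ h
    rw [key, key] at h
    obtain rfl := Subtype.ext h
    rw [FaceLift.eq_of_mem_vertexSet hq hb hb']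

/-- The projection of the lifted complex to `K`. -/
noncomputable def liftedComplexProj (hq : IsCoveringMap q) :
    SimplicialMap (liftedComplex hq) K where
  toFun := LiftedVertex.base
  image_mem := by
    rintro _ ⟨s, L, rfl⟩
    exact ⟨s, s.2, L.base_image_vertexSet.symm⟩

/-! ### The homeomorphism from the realization of the lifted complex -/

namespace FaceLift

variable {s t : K.faces} (hq : IsCoveringMap q)

/-- The face of the lifted complex spanned by a lifted simplex. -/
noncomputable def face (L : FaceLift q s) : (liftedComplex hq).faces := ⟨L.vertexSet, s, L, rfl⟩

/-- A lifted simplex has as many vertices as the simplex downstairs. -/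
noncomputable def vertexEquiv (L : FaceLift q s) :
    (s : Finset V) ≃ (L.face hq : Finset (LiftedVertex q)) :=
  Equiv.ofBijective (fun a => ⟨L.vertex a, mem_vertexSet.2 ⟨a, rfl⟩⟩)
    ⟨fun _ _ h => L.vertex_injective (congrArg Subtype.val h),
      fun ⟨_, hb⟩ => (mem_vertexSet.1 hb).imp fun _ h => Subtype.ext h⟩

/-- The abstract counterpart of a lifted simplex `L`: the closed simplex of the realization of the
lifted complex spanned by the vertices of `L`, with the same barycentric coordinates. -/
noncomputable def realize (L : FaceLift q s) (z : stdSimplex ℝ (s : Finset V)) :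
    (liftedComplex hq).Realization :=
  (liftedComplex hq).faceInclusion (L.face hq) (stdSimplex.map (L.vertexEquiv hq) z)

theorem continuous_realize (L : FaceLift q s) : Continuous (L.realize hq) :=
  (continuous_faceInclusion _ _).comp (stdSimplex.continuous_map _)

theorem realize_coords (L : FaceLift q s) (z : stdSimplex ℝ (s : Finset V)) :
    (L.realize hq z).coords = (Finsupp.equivFunOnFinite.symm z.1).mapDomain L.vertex :=
  faceInclusion_map_coords _ _ _

theorem restrict_realize (L : FaceLift q t) (h : (s : Finset V) ⊆ t)
    (z : stdSimplex ℝ (s : Finset V)) :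
    (L.restrict h).realize hq z = L.realize hq (stdSimplex.map (Set.inclusion h) z) := by
  refine Realization.ext ?_
  rw [realize_coords, realize_coords, funext (L.restrict_vertex h)]
  rw [equivFunOnFinite_symm_map, ← Finsupp.mapDomain_comp]
  rfl

theorem proj_realize (L : FaceLift q s) (z : stdSimplex ℝ (s : Finset V)) :
    (liftedComplexProj hq).realization (L.realize hq z) = q (L.map z) := by
  rw [L.proj]
  refine Realization.ext ?_
  change (L.realize hq z).coords.mapDomain LiftedVertex.base = Finsupp.mapDomain _ _
  rw [realize_coords, ← Finsupp.mapDomain_comp]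
  congr 1
  exact funext L.base_vertex

/-- Each point of a simplex of the lifted complex comes from the lift defining the simplex. -/
theorem realize_map_symm (L : FaceLift q s)
    (w : stdSimplex ℝ (L.face hq : Finset (LiftedVertex q))) :
    L.realize hq (stdSimplex.map (L.vertexEquiv hq).symm w) =
      (liftedComplex hq).faceInclusion (L.face hq) w := by
  rw [realize, stdSimplex.map_comp_apply, Equiv.self_comp_symm, stdSimplex.map_id_apply]

/-- Each point of a lifted simplex lies on a lift of the carrier of its image in `|K|`, with the
same point of the realization of the lifted complex. -/
theorem exists_carrier (L : FaceLift q s) (z : stdSimplex ℝ (s : Finset V)) :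
    ∃ (L₀ : FaceLift q (q (L.map z)).carrier) (z₀ : stdSimplex ℝ _),
      K.faceInclusion _ z₀ = q (L.map z) ∧ L₀.map z₀ = L.map z ∧
        L₀.realize hq z₀ = L.realize hq z := by
  have hsub : ((q (L.map z)).carrier : Finset V) ⊆ s := by
    rw [L.proj]
    exact faceInclusion_support_subset s z
  obtain ⟨z₀, hz₀⟩ := (q (L.map z)).exists_faceInclusion_carrier
  have hz : stdSimplex.map (Set.inclusion hsub) z₀ = z :=
    faceInclusion_injective s (by rw [faceInclusion_map_inclusion, hz₀, L.proj])
  exact ⟨L.restrict hsub, z₀, hz₀, congrArg L.map hz, by rw [restrict_realize, hz]⟩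

/-- Points of lifted simplices coincide in `E` if and only if they coincide in the realization of
the lifted complex. -/
theorem map_eq_map_iff (L : FaceLift q s) (L' : FaceLift q t) (z : stdSimplex ℝ (s : Finset V))
    (z' : stdSimplex ℝ (t : Finset V)) :
    L.map z = L'.map z' ↔ L.realize hq z = L'.realize hq z' := by
  obtain ⟨M, y, hy, hM, hMr⟩ := L.exists_carrier hq z
  obtain ⟨M', y', hy', hM', hMr'⟩ := L'.exists_carrier hq z'
  rw [← hM, ← hM', ← hMr, ← hMr']
  -- Either equality forces the two points to have the same image in `|K|`, hence a common carrier.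
  suffices H : ∀ x x' : K.Realization, x = x' → ∀ (M : FaceLift q x.carrier)
      (M' : FaceLift q x'.carrier) (y) (y'), K.faceInclusion _ y = x → K.faceInclusion _ y' = x' →
      (M.map y = M'.map y' ↔ M.realize hq y = M'.realize hq y') by
    refine ⟨fun h => (H _ _ ?_ M M' y y' hy hy').1 h, fun h => (H _ _ ?_ M M' y y' hy hy').2 h⟩
    · rw [← hM, ← hM', h]
    · rw [← proj_realize hq L, ← proj_realize hq L', ← hMr, ← hMr', h]
  rintro x _ rfl M M' y y' hy hy'
  obtain rfl := faceInclusion_injective _ (hy.trans hy'.symm)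
  refine ⟨fun h => by rw [eq_of_apply_eq hq y h], fun h => ?_⟩
  suffices M = M' by rw [this]
  -- A point and its carrier determine the support upstairs, which is the set of all vertices.
  obtain ⟨a⟩ := K.nonempty_face x.carrier
  have ha : y a ≠ 0 := by
    rw [← faceInclusion_coords_apply, hy]
    exact Finsupp.mem_support_iff.1 a.2
  refine eq_of_mem_vertexSet hq (mem_vertexSet.2 ⟨a, rfl⟩)
    (faceInclusion_support_subset (M'.face hq) (stdSimplex.map (M'.vertexEquiv hq) y)
      (Finsupp.mem_support_iff.2 ?_))
  change (M'.realize hq y).coords _ ≠ 0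
  rw [← h, realize_coords, Finsupp.mapDomain_apply M.vertex_injective]
  exact ha

end FaceLift

theorem exists_faceLift_apply_eq (hq : IsCoveringMap q) (e : E) :
    ∃ (s : K.faces) (L : FaceLift q s) (z : _), L.map z = e := by
  obtain ⟨z, hz⟩ := (q e).exists_faceInclusion_carrier
  obtain ⟨L, hL⟩ := FaceLift.exists_of_proj_eq hq z e hz.symm
  exact ⟨_, L, z, hL⟩

theorem exists_faceLift_realize_eq (hq : IsCoveringMap q) (c : (liftedComplex hq).Realization) :
    ∃ (s : K.faces) (L : FaceLift q s) (z : _), L.realize hq z = c := by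
  obtain ⟨w, hw⟩ := c.exists_faceInclusion_carrier
  generalize c.carrier = t at w hw
  obtain ⟨_, s, L, rfl⟩ := t
  exact ⟨s, L, _, (L.realize_map_symm hq w).trans hw⟩

/-- The total space has the weak topology with respect to the lifted simplices. -/
theorem isOpen_of_forall_faceLift (hq : IsCoveringMap q) {U : Set E}
    (hU : ∀ (s : K.faces) (L : FaceLift q s), IsOpen (L.map ⁻¹' U)) : IsOpen U := by
  refine isOpen_iff_mem_nhds.2 fun e he => ?_
  obtain ⟨φ, hφe, hφ⟩ := hq.isLocalHomeomorph e
  -- Within a sheet `φ.source`, openness can be tested on the image in `|K|`, hence on simplices.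
  have hopen : IsOpen (q '' (φ.source ∩ U)) := by
    refine Realization.isOpen_iff.2 fun s => isOpen_iff_mem_nhds.2 fun z hz => ?_
    obtain ⟨e', ⟨he', heU⟩, hez⟩ := hz
    obtain ⟨L, rfl⟩ := FaceLift.exists_of_proj_eq hq z e' hez
    filter_upwards [((φ.open_source.preimage L.map.continuous).inter (hU s L)).mem_nhds
      ⟨he', heU⟩] with w hw
    exact ⟨L.map w, hw, L.proj w⟩
  have hmem : φ.source ∩ q ⁻¹' (q '' (φ.source ∩ U)) ∈ 𝓝 e :=
    (φ.open_source.inter (hopen.preimage hq.continuous)).mem_nhds ⟨hφe, e, ⟨hφe, he⟩, rfl⟩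
  filter_upwards [hmem] with e' he'
  obtain ⟨e'', ⟨hs, hU'⟩, h⟩ := he'.2
  rw [hφ] at h
  exact φ.injOn hs he'.1 h ▸ hU'

theorem continuous_of_forall_faceLift (hq : IsCoveringMap q) {Y : Type*} [TopologicalSpace Y]
    {g : E → Y} (hg : ∀ (s : K.faces) (L : FaceLift q s), Continuous (g ∘ L.map)) :
    Continuous g :=
  ⟨fun _ hW => isOpen_of_forall_faceLift hq fun s L => hW.preimage (hg s L)⟩

/-- The canonical homeomorphism from the realization of the lifted complex to the covering space:
it sends the abstract simplex of each lift to the lift. -/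
theorem exists_homeomorph_realize (hq : IsCoveringMap q) :
    ∃ σ : (liftedComplex hq).Realization ≃ₜ E,
      ∀ (s : K.faces) (L : FaceLift q s) (z : _), σ (L.realize hq z) = L.map z := by
  choose s L z hz using exists_faceLift_realize_eq hq
  choose s' L' z' hz' using exists_faceLift_apply_eq hq
  have to_apply : ∀ {t : K.faces} (M : FaceLift q t) (w : _),
      (L (M.realize hq w)).map (z (M.realize hq w)) = M.map w := fun M w =>
    (FaceLift.map_eq_map_iff hq _ _ _ _).2 (hz _)
  have inv_apply : ∀ {t : K.faces} (M : FaceLift q t) (w : _),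
      (L' (M.map w)).realize hq (z' (M.map w)) = M.realize hq w := fun M w =>
    (FaceLift.map_eq_map_iff hq _ _ _ _).1 (hz' _)
  refine ⟨{ toFun := fun c => (L c).map (z c)
            invFun := fun e => (L' e).realize hq (z' e)
            left_inv := fun c => (inv_apply _ _).trans (hz c)
            right_inv := fun e => (to_apply _ _).trans (hz' e)
            continuous_toFun := Realization.continuous_iff.2 ?_
            continuous_invFun := continuous_of_forall_faceLift hq fun t M => ?_ },
    fun t M w => to_apply M w⟩
  · rintro ⟨_, t, M, rfl⟩
    refine (M.map.continuous.comp
      (stdSimplex.continuous_map (M.vertexEquiv hq).symm)).congr fun w => ?_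
    exact (to_apply M _).symm.trans
      (congrArg (fun c => (L c).map (z c)) (M.realize_map_symm hq w))
  · exact (M.continuous_realize hq).congr fun w => (inv_apply M w).symm

end Lift

end AbstractSimplicialComplex

theorem mainTheorem10 {X : Type u} {X' : Type v} {V : Type w} [TopologicalSpace X]
    [TopologicalSpace X'] (K : AbstractSimplicialComplex V) (hdim : K.IsFiniteDimensional)
    (hlf : K.IsLocallyFinite) (τ : K.Triangulation X) (p : X' → X) (hp : IsCoveringMap p) :
    ∃ (V' : Type v) (K' : AbstractSimplicialComplex V') (τ' : K'.Triangulation X'),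
      K'.IsLocallyFinite ∧ AbstractSimplicialComplex.IsSimplicialFor τ' τ p := by
  open AbstractSimplicialComplex in
  have hq : IsCoveringMap (τ.symm ∘ p) := hp.homeomorph_comp τ.symm
  obtain ⟨σ, hσ⟩ := exists_homeomorph_realize hq
  refine ⟨_, liftedComplex hq, σ, liftedComplex_isLocallyFinite hq hlf, liftedComplexProj hq,
    fun c => ?_⟩
  obtain ⟨s, L, z, rfl⟩ := exists_faceLift_realize_eq hq c
  rw [hσ, L.proj_realize]
  rfl
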